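/- Let $K$ be a field, let $C$ be a (coassociative, counital) $K$-coalgebra with comultiplication $\Delta$ and counit $\varepsilon$, and let $\mathcal D$ be a small $K$-linear category. Let $\psi=\{\psi_{XY}:C\otimes \mathrm{Hom}_{\mathcal D}(X,Y)\to \mathrm{Hom}_{\mathcal D}(X,Y)\otimes C\}_{X,Y\in\mathcal D}$ be a family of $K$-linear maps, written $\psi_{XY}(c\otimes f)=f_\psi\otimes c^\psi$, such that $(\mathcal D,C,\psi)$ is a (right-right) entwining structure, i.e. $$(gf)_\psi\otimes c^\psi=g_\psi f_\psi\otimes {c^\psi}^\psi,\qquad \varepsilon(c^\psi)f_\psi=\varepsilon(c)f,$$ $$f_\psi\otimes\Delta(c^\psi)={f_\psi}_\psi\otimes {c_1}^\psi\otimes {c_2}^\psi,\qquad \psi_{XX}(c\otimes \mathrm{id}_X)=\mathrm{id}_X\otimes c$$ for all $f\in \mathrm{Hom}_{\mathcal D}(X,Y)$, $g\in \mathrm{Hom}_{\mathcal D}(Y,Z)$, $c\in C$. An entwined module is a $K$-linear functor $\mathcal M:\mathcal D^{op}\to \mathrm{Vect}_K$ together with a right $C$-comodule structure $m\mapsto m_0\otimes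 m_1$ on each $\mathcal M(X)$ such that $(\mathcal M(f)(m))_0\otimes(\mathcal M(f)(m))_1=\mathcal M(f_\psi)(m_0)\otimes {m_1}^\psi$ for all $f\in \mathrm{Hom}_{\mathcal D}(Y,X)$ and $m\in\mathcal M(X)$. Let $\mathscr M(\psi)^C_{\mathcal D}$ be the category of entwined modules, whose morphisms are the natural transformations all of whose components are $C$-colinear, with pointwise addition of morphisms. For a right $C$-comodule $V$ and an object $X$ of $\mathcal D$, let $V\otimes \mathbf h_X$ be the entwined module with $(V\otimes\mathbf h_X)(Y)=V\otimes \mathrm{Hom}_{\mathcal D}(Y,X)$, $(V\otimes \mathbf h_X)(f)(v\otimes g)=v\otimes gf$ and coaction $v\otimes g\mapsto v_0\otimes g_\psi\otimes {v_1}^\psi$. Then $\mathscr M(\psi)^C_{\mathcal D}$ is a Grothendieck category: it is abelian, has all small filtered colimits (hence is cocomplete), filtered colimits in it are exact (AB5), and it has a generator. Moreover, the objects isomorphic to $V\otimes \mathbf h_X$, with $V$ a finite-dimensional right $C$-comodule and $X$ an object of $\mathcal D$, form only a set of isomorphism classes and are a generating set: for every entwined module $\mathcal A$ and every proper subobject $\mathcal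 B\subsetneq\mathcal A$ some morphism $V\otimes\mathbf h_X\to\mathcal A$ with such $V$, $X$ does not factor through $\mathcal B$, and two parallel morphisms of entwined modules that agree after composition with every morphism out of every such $V\otimes \mathbf h_X$ are equal. -/

import Mathlib

open CategoryTheory Opposite TensorProduct

universe u

namespace Entwined

section Coactions

/-- A right comodule structure on the `K`-vector space `V` over the `K`-coalgebra `C`: a linear map
`ρ : V → V ⊗ C` which is coassociative and counital. -/
structure RightCoaction (K : Type u) (C : Type u) [Field K] [AddCommGroup C] [Module K C]
    [Coalgebra K C] (V : Type u) [AddCommGroup V] [Module K V] where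
  ρ : V →ₗ[K] V ⊗[K] C
  coassoc : (TensorProduct.assoc K V C C).toLinearMap ∘ₗ ρ.rTensor C ∘ₗ ρ
      = (Coalgebra.comul (R := K) (A := C)).lTensor V ∘ₗ ρ
  counit : (TensorProduct.rid K V).toLinearMap ∘ₗ
      (Coalgebra.counit (R := K) (A := C)).lTensor V ∘ₗ ρ = LinearMap.id

end Coactions

section Entwinings

variable (K : Type u) [Field K] (C : Type u) [AddCommGroup C] [Module K C] [Coalgebra K C]
  (D : Type u) [Category.{u} D] [Preadditive D] [Linear K D]

variable {D} in
/-- Composition `Hom(Y, Z) ⊗ Hom(X, Y) → Hom(X, Z)`, `g ⊗ f ↦ g ∘ f`. -/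
def compMap (X Y Z : D) : (Y ⟶ Z) ⊗[K] (X ⟶ Y) →ₗ[K] (X ⟶ Z) :=
  TensorProduct.lift (Linear.comp (S := K) X Y Z).flip

/-- A (right-right) entwining of the `K`-linear category `D` with the `K`-coalgebra `C`: linear maps
`ψ_{XY} : C ⊗ Hom(X, Y) → Hom(X, Y) ⊗ C`, written `ψ(c ⊗ f) = f_ψ ⊗ c^ψ`. -/
structure Entwining where
  ψ : ∀ X Y : D, C ⊗[K] (X ⟶ Y) →ₗ[K] (X ⟶ Y) ⊗[K] C
  /-- `(g f)_ψ ⊗ c^ψ = g_ψ f_ψ ⊗ c^ψ^ψ` -/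
  ψ_comp : ∀ X Y Z : D,
    ψ X Z ∘ₗ (compMap K X Y Z).lTensor C ∘ₗ
        (TensorProduct.assoc K C (Y ⟶ Z) (X ⟶ Y)).toLinearMap
      = (compMap K X Y Z).rTensor C ∘ₗ
        (TensorProduct.assoc K (Y ⟶ Z) (X ⟶ Y) C).symm.toLinearMap ∘ₗ
        (ψ X Y).lTensor (Y ⟶ Z) ∘ₗ
        (TensorProduct.assoc K (Y ⟶ Z) C (X ⟶ Y)).toLinearMap ∘ₗ
        (ψ Y Z).rTensor (X ⟶ Y)
  /-- `ε(c^ψ) f_ψ = ε(c) f` -/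
  ψ_counit : ∀ X Y : D,
    (TensorProduct.rid K (X ⟶ Y)).toLinearMap ∘ₗ
        (Coalgebra.counit (R := K) (A := C)).lTensor (X ⟶ Y) ∘ₗ ψ X Y
      = (TensorProduct.lid K (X ⟶ Y)).toLinearMap ∘ₗ
        (Coalgebra.counit (R := K) (A := C)).rTensor (X ⟶ Y)
  /-- `f_ψ ⊗ Δ(c^ψ) = f_ψ_ψ ⊗ c₁^ψ ⊗ c₂^ψ` -/
  ψ_comul : ∀ X Y : D,
    (Coalgebra.comul (R := K) (A := C)).lTensor (X ⟶ Y) ∘ₗ ψ X Y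
      = (TensorProduct.assoc K (X ⟶ Y) C C).toLinearMap ∘ₗ
        (ψ X Y).rTensor C ∘ₗ
        (TensorProduct.assoc K C (X ⟶ Y) C).symm.toLinearMap ∘ₗ
        (ψ X Y).lTensor C ∘ₗ
        (TensorProduct.assoc K C C (X ⟶ Y)).toLinearMap ∘ₗ
        (Coalgebra.comul (R := K) (A := C)).rTensor (X ⟶ Y)
  /-- `ψ(c ⊗ id) = id ⊗ c` -/
  ψ_id : ∀ (X : D) (c : C), ψ X X (c ⊗ₜ[K] 𝟙 X) = 𝟙 X ⊗ₜ[K] c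

/-- A right module over the `K`-linear category `D`: a `K`-linear functor from `Dᵒᵖ` to the category
of `K`-vector spaces. -/
structure RightModule where
  F : Dᵒᵖ ⥤ ModuleCat.{u} K
  map_add : ∀ {X Y : D} (f g : Y ⟶ X), F.map (f + g).op = F.map f.op + F.map g.op
  map_smul : ∀ {X Y : D} (r : K) (f : Y ⟶ X), F.map (r • f).op = r • F.map f.op

variable {K D}

/-- The action `M(X) ⊗ Hom(Y, X) → M(Y)`, `m ⊗ f ↦ M(f)(m)`, of a right module `M`. -/
def RightModule.act (M : RightModule K D) (X Y : D) :
    M.F.obj (op X) ⊗[K] (Y ⟶ X) →ₗ[K] M.F.obj (op Y) :=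
  TensorProduct.lift <| LinearMap.flip
    { toFun := fun f => (M.F.map f.op).hom
      map_add' := fun f g => by rw [M.map_add]; rfl
      map_smul' := fun r f => by rw [M.map_smul]; rfl }

@[simp]
theorem RightModule.act_tmul (M : RightModule K D) (X Y : D) (m : M.F.obj (op X)) (f : Y ⟶ X) :
    M.act X Y (m ⊗ₜ[K] f) = (M.F.map f.op).hom m := rfl

variable {C}

/-- For a space `V` with coaction `ρ`, the map `V ⊗ Hom(Y, X) → (V ⊗ Hom(Y, X)) ⊗ C`,
`v ⊗ f ↦ (v₀ ⊗ f_ψ) ⊗ v₁^ψ`. -/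
def Entwining.twist (E : Entwining K C D) {V : Type u} [AddCommGroup V] [Module K V]
    (ρ : V →ₗ[K] V ⊗[K] C) (X Y : D) :
    V ⊗[K] (Y ⟶ X) →ₗ[K] (V ⊗[K] (Y ⟶ X)) ⊗[K] C :=
  (TensorProduct.assoc K V (Y ⟶ X) C).symm.toLinearMap ∘ₗ
    (E.ψ Y X).lTensor V ∘ₗ
    (TensorProduct.assoc K V C (Y ⟶ X)).toLinearMap ∘ₗ
    ρ.rTensor (Y ⟶ X)

theorem Entwining.twist_tmul (E : Entwining K C D) {V : Type u} [AddCommGroup V] [Module K V]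
    (ρ : V →ₗ[K] V ⊗[K] C) {X Y : D} (v : V) (f : Y ⟶ X) :
    E.twist ρ X Y (v ⊗ₜ[K] f) =
      (TensorProduct.assoc K V (Y ⟶ X) C).symm
        ((E.ψ Y X ∘ₗ (TensorProduct.mk K C (Y ⟶ X)).flip f).lTensor V (ρ v)) := by
  simp only [Entwining.twist, LinearMap.comp_apply, LinearMap.rTensor_tmul,
    LinearEquiv.coe_coe]
  congr 1
  induction ρ v with
  | zero => simp
  | tmul w c => simp
  | add a b ha hb => simp only [TensorProduct.add_tmul, map_add, ha, hb]

/-- An entwined module: a right `D`-module `M` with a right `C`-comodule structure on each `M(X)`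
such that `ρ(M(f)(m)) = M(f_ψ)(m₀) ⊗ m₁^ψ` for `f : Y ⟶ X` and `m ∈ M(X)`. -/
structure EntwinedModule (E : Entwining K C D) extends RightModule K D where
  coact : ∀ X : D, RightCoaction K C (F.obj (op X))
  compat : ∀ X Y : D,
    (coact Y).ρ ∘ₗ toRightModule.act X Y
      = (toRightModule.act X Y).rTensor C ∘ₗ E.twist (coact X).ρ X Y

namespace EntwinedModule

variable {E : Entwining K C D}

/-- A morphism of entwined modules: a morphism of right `D`-modules all of whose components are
`C`-colinear. -/
@[ext]
structure Hom (M N : EntwinedModule E) where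
  nat : M.F ⟶ N.F
  colinear : ∀ X : D,
    (nat.app (op X)).hom.rTensor C ∘ₗ (M.coact X).ρ = (N.coact X).ρ ∘ₗ (nat.app (op X)).hom

instance : Category (EntwinedModule E) where
  Hom := Hom
  id M := ⟨𝟙 M.F, fun X => by ext x; simp⟩
  comp f g := ⟨f.nat ≫ g.nat, fun X => by
    rw [NatTrans.comp_app, ModuleCat.hom_comp, LinearMap.rTensor_comp, LinearMap.comp_assoc,
      f.colinear, ← LinearMap.comp_assoc, g.colinear, LinearMap.comp_assoc]⟩
  id_comp f := Hom.ext (Category.id_comp f.nat)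
  comp_id f := Hom.ext (Category.comp_id f.nat)
  assoc f g h := Hom.ext (Category.assoc f.nat g.nat h.nat)

@[simp]
theorem id_nat (M : EntwinedModule E) : Hom.nat (𝟙 M) = 𝟙 M.F := rfl

@[simp]
theorem comp_nat {M N P : EntwinedModule E} (f : M ⟶ N) (g : N ⟶ P) :
    Hom.nat (f ≫ g) = f.nat ≫ g.nat := rfl

@[ext]
theorem hom_ext {M N : EntwinedModule E} {f g : M ⟶ N} (h : f.nat = g.nat) : f = g := Hom.ext h

variable {M N : EntwinedModule E}

instance : Zero (M ⟶ N) := ⟨⟨0, fun X => by simp⟩⟩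

instance : Add (M ⟶ N) := ⟨fun f g => ⟨f.nat + g.nat, fun X => by
  simp only [NatTrans.app_add, ModuleCat.hom_add, LinearMap.rTensor_add, LinearMap.add_comp,
    LinearMap.comp_add, f.colinear, g.colinear]⟩⟩

instance : Neg (M ⟶ N) := ⟨fun f => ⟨-f.nat, fun X => by
  simp only [NatTrans.app_neg, ModuleCat.hom_neg, LinearMap.rTensor_neg, LinearMap.neg_comp,
    LinearMap.comp_neg, f.colinear]⟩⟩

/-- Morphisms of entwined modules are added pointwise. -/
instance : AddCommGroup (M ⟶ N) where
  add_assoc f g h := hom_ext (add_assoc f.nat g.nat h.nat)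
  zero_add f := hom_ext (zero_add f.nat)
  add_zero f := hom_ext (add_zero f.nat)
  neg_add_cancel f := hom_ext (neg_add_cancel f.nat)
  add_comm f g := hom_ext (add_comm f.nat g.nat)
  nsmul := nsmulRec
  zsmul := zsmulRec

instance instPreadditive : Preadditive (EntwinedModule E) where
  add_comp _ _ _ f g h := hom_ext (Preadditive.add_comp _ _ _ f.nat g.nat h.nat)
  comp_add _ _ _ f g h := hom_ext (Preadditive.comp_add _ _ _ f.nat g.nat h.nat)

end EntwinedModule

section TensorRepresentable

variable (V : Type u) [AddCommGroup V] [Module K V]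

variable (K) in
/-- The right `D`-module `V ⊗ h_X`, where `h_X = Hom(-, X)`: its value at `Y` is `V ⊗ Hom(Y, X)`,
and `f : Z ⟶ Y` acts by `v ⊗ g ↦ v ⊗ (g ∘ f)`. -/
def tensorRepresentableModule (X : D) : RightModule K D where
  F :=
    { obj := fun Y => ModuleCat.of K (V ⊗[K] (Y.unop ⟶ X))
      map := fun f => ModuleCat.ofHom ((Linear.leftComp K X f.unop).lTensor V)
      map_id := fun Y => by
        ext : 1
        refine TensorProduct.ext' fun v g => ?_
        simp
      map_comp := fun f g => by
        ext : 1
        refine TensorProduct.ext' fun v g => ?_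
        simp }
  map_add f g := by
    ext : 1
    refine TensorProduct.ext' fun v h => ?_
    simp [TensorProduct.tmul_add]
  map_smul r f := by
    ext : 1
    refine TensorProduct.ext' fun v h => ?_
    simp

variable {V}

/-- The coaction `v ⊗ g ↦ v₀ ⊗ g_ψ ⊗ v₁^ψ` on `V ⊗ Hom(Y, X)`. -/
def tensorRepresentableCoaction (E : Entwining K C D) (δ : RightCoaction K C V) (X Y : D) :
    RightCoaction K C (V ⊗[K] (Y ⟶ X)) where
  ρ := E.twist δ.ρ X Y
  coassoc := by
    refine TensorProduct.ext' fun v g => ?_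
    have key : ∀ t : V ⊗[K] C,
        TensorProduct.assoc K (V ⊗[K] (Y ⟶ X)) C C ((E.twist δ.ρ X Y).rTensor C
          ((TensorProduct.assoc K V (Y ⟶ X) C).symm
            ((E.ψ Y X ∘ₗ (TensorProduct.mk K C (Y ⟶ X)).flip g).lTensor V t))) =
        (TensorProduct.assoc K V (Y ⟶ X) (C ⊗[K] C)).symm
          (((TensorProduct.assoc K (Y ⟶ X) C C).toLinearMap ∘ₗ (E.ψ Y X).rTensor C ∘ₗ
            (TensorProduct.assoc K C (Y ⟶ X) C).symm.toLinearMap ∘ₗ (E.ψ Y X).lTensor C ∘ₗ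
            (TensorProduct.assoc K C C (Y ⟶ X)).toLinearMap ∘ₗ
            (TensorProduct.mk K (C ⊗[K] C) (Y ⟶ X)).flip g).lTensor V
            (TensorProduct.assoc K V C C (δ.ρ.rTensor C t))) := by
      intro t
      induction t with
      | zero => simp
      | add a b ha hb => simp only [map_add, ha, hb]
      | tmul w d =>
        have h2 : ∀ t' : V ⊗[K] C,
            (TensorProduct.assoc K V C C (t' ⊗ₜ[K] d)) =
              ((TensorProduct.mk K C C).flip d).lTensor V t' := by
          intro t'
          induction t' with
          | zero => simp
          | add a b ha hb => simp only [TensorProduct.add_tmul, map_add, ha, hb]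
          | tmul a b => simp
        simp only [LinearMap.lTensor_tmul, LinearMap.rTensor_tmul, h2, LinearMap.comp_apply,
          LinearMap.flip_apply, TensorProduct.mk_apply]
        rw [← LinearMap.comp_apply (LinearMap.lTensor V _) (LinearMap.lTensor V _),
          ← LinearMap.lTensor_comp]
        have h3 : ((TensorProduct.assoc K (Y ⟶ X) C C).toLinearMap ∘ₗ (E.ψ Y X).rTensor C ∘ₗ
            (TensorProduct.assoc K C (Y ⟶ X) C).symm.toLinearMap ∘ₗ (E.ψ Y X).lTensor C ∘ₗ
            (TensorProduct.assoc K C C (Y ⟶ X)).toLinearMap ∘ₗ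
            (TensorProduct.mk K (C ⊗[K] C) (Y ⟶ X)).flip g) ∘ₗ (TensorProduct.mk K C C).flip d =
            (TensorProduct.assoc K (Y ⟶ X) C C).toLinearMap ∘ₗ (E.ψ Y X).rTensor C ∘ₗ
            (TensorProduct.assoc K C (Y ⟶ X) C).symm.toLinearMap ∘ₗ
            (TensorProduct.mk K C ((Y ⟶ X) ⊗[K] C)).flip (E.ψ Y X (d ⊗ₜ[K] g)) := by
          ext c
          simp
        rw [h3]
        induction E.ψ Y X (d ⊗ₜ[K] g) with
        | zero => simp
        | add a b ha hb =>
          simp only [TensorProduct.tmul_add, map_add, ha, hb, LinearMap.comp_add,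
            LinearMap.lTensor_add, LinearMap.add_apply]
        | tmul h e =>
          simp only [TensorProduct.assoc_symm_tmul, LinearMap.rTensor_tmul, E.twist_tmul]
          induction δ.ρ w with
          | zero => simp
          | add a b ha hb => simp only [TensorProduct.add_tmul, map_add, ha, hb]
          | tmul x c =>
            simp only [LinearMap.lTensor_tmul, LinearMap.comp_apply, LinearMap.flip_apply,
              TensorProduct.mk_apply, LinearEquiv.coe_coe, TensorProduct.assoc_symm_tmul,
              LinearMap.rTensor_tmul]
            induction E.ψ Y X (c ⊗ₜ[K] h) with
            | zero => simp
            | add a b ha hb =>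
              simp only [TensorProduct.tmul_add, TensorProduct.add_tmul, map_add, ha, hb]
            | tmul a b => simp
    have hco := LinearMap.congr_fun δ.coassoc v
    simp only [LinearMap.comp_apply, LinearEquiv.coe_coe] at hco
    simp only [LinearMap.comp_apply, LinearEquiv.coe_coe, E.twist_tmul]
    rw [key, hco]
    induction δ.ρ v with
    | zero => simp
    | add a b ha hb => simp only [map_add, ha, hb]
    | tmul w c =>
      have hψ := LinearMap.congr_fun (E.ψ_comul Y X) (c ⊗ₜ[K] g)
      simp only [LinearMap.comp_apply, LinearEquiv.coe_coe, LinearMap.rTensor_tmul] at hψ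
      simp only [LinearMap.lTensor_tmul, LinearMap.comp_apply, LinearMap.flip_apply,
        TensorProduct.mk_apply, LinearEquiv.coe_coe]
      rw [← hψ]
      induction E.ψ Y X (c ⊗ₜ[K] g) with
      | zero => simp
      | add a b ha hb => simp only [TensorProduct.tmul_add, map_add, ha, hb]
      | tmul a b => simp
  counit := by
    refine TensorProduct.ext' fun v g => ?_
    have hco := LinearMap.congr_fun δ.counit v
    simp only [LinearMap.comp_apply, LinearEquiv.coe_coe, LinearMap.id_apply] at hco
    simp only [LinearMap.comp_apply, LinearEquiv.coe_coe, E.twist_tmul, LinearMap.id_apply]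
    conv_rhs => rw [← hco]
    induction δ.ρ v with
    | zero => simp
    | add a b ha hb => simp only [TensorProduct.add_tmul, map_add, ha, hb]
    | tmul w c =>
      have hψ := LinearMap.congr_fun (E.ψ_counit Y X) (c ⊗ₜ[K] g)
      simp only [LinearMap.comp_apply, LinearEquiv.coe_coe, LinearMap.rTensor_tmul,
        TensorProduct.lid_tmul] at hψ
      simp only [LinearMap.lTensor_tmul, LinearMap.comp_apply, LinearMap.flip_apply,
        TensorProduct.mk_apply, TensorProduct.rid_tmul, TensorProduct.smul_tmul]
      rw [← hψ]
      induction E.ψ Y X (c ⊗ₜ[K] g) with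
      | zero => simp
      | add a b ha hb => simp only [TensorProduct.tmul_add, map_add, ha, hb]
      | tmul a b => simp

/-- The entwined module `V ⊗ h_X` attached to a right `C`-comodule `V` and an object `X` of `D`. -/
def tensorRepresentable (E : Entwining K C D) (δ : RightCoaction K C V) (X : D) :
    EntwinedModule E where
  toRightModule := tensorRepresentableModule K V X
  coact Y := tensorRepresentableCoaction E δ X Y
  compat Y Z := by
    refine TensorProduct.ext_threefold fun v g f => ?_
    obtain ⟨A, hA, hact⟩ : ∃ A : (V ⊗[K] (Y ⟶ X)) ⊗[K] (Z ⟶ Y) →ₗ[K] V ⊗[K] (Z ⟶ X),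
        A = (tensorRepresentableModule K V X).act Y Z ∧
          ∀ v g f, A ((v ⊗ₜ[K] g) ⊗ₜ[K] f) = v ⊗ₜ[K] (f ≫ g) :=
      ⟨(tensorRepresentableModule K V X).act Y Z, rfl, fun _ _ _ => rfl⟩
    suffices main : E.twist δ.ρ X Z (v ⊗ₜ[K] (f ≫ g)) =
        A.rTensor C ((TensorProduct.assoc K (V ⊗[K] (Y ⟶ X)) (Z ⟶ Y) C).symm
          ((E.ψ Z Y ∘ₗ (TensorProduct.mk K C (Z ⟶ Y)).flip f).lTensor (V ⊗[K] (Y ⟶ X))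
            (E.twist δ.ρ X Y (v ⊗ₜ[K] g)))) by
      rw [hA, ← E.twist_tmul (E.twist δ.ρ X Y)] at main
      exact main
    simp only [E.twist_tmul]
    induction δ.ρ v with
    | zero => simp
    | add a b ha hb => simp only [map_add, ha, hb]
    | tmul w c =>
      have hψ := LinearMap.congr_fun (E.ψ_comp Z Y X) ((c ⊗ₜ[K] g) ⊗ₜ[K] f)
      simp only [LinearMap.comp_apply, LinearEquiv.coe_coe, LinearMap.rTensor_tmul,
        TensorProduct.assoc_tmul, LinearMap.lTensor_tmul, compMap, TensorProduct.lift.tmul,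
        LinearMap.flip_apply, Linear.comp_apply, Linear.leftComp_apply] at hψ
      simp only [LinearMap.lTensor_tmul, LinearMap.comp_apply, LinearMap.flip_apply,
        TensorProduct.mk_apply, hψ]
      induction E.ψ Y X (c ⊗ₜ[K] g) with
      | zero => simp
      | add a b ha hb =>
        simp only [TensorProduct.add_tmul, TensorProduct.tmul_add, map_add, ha, hb]
      | tmul h d =>
        simp only [TensorProduct.assoc_tmul, TensorProduct.assoc_symm_tmul,
          LinearMap.lTensor_tmul, LinearMap.comp_apply, LinearMap.flip_apply,
          TensorProduct.mk_apply]
        induction E.ψ Z Y (d ⊗ₜ[K] f) with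
        | zero => simp
        | add a b ha hb =>
          simp only [TensorProduct.tmul_add, map_add, ha, hb]
        | tmul a b =>
          simp [hact]

end TensorRepresentable

/-- The entwined modules isomorphic to `V ⊗ h_X` for some finite-dimensional right `C`-comodule `V`
and some object `X` of `D`. -/
def finiteTensorRepresentable (E : Entwining K C D) : ObjectProperty (EntwinedModule E) :=
  fun M => ∃ (V : Type u) (_ : AddCommGroup V) (_ : Module K V) (_ : FiniteDimensional K V)
    (δ : RightCoaction K C V) (X : D), Nonempty (M ≅ tensorRepresentable E δ X)

end Entwinings

/-- A class `P` of objects is generating if for every object `A` and every proper subobject of `A`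
there is a morphism from a member of `P` to `A` that does not factor through the subobject. -/
def IsGenerating {𝒜 : Type*} [Category 𝒜] (P : ObjectProperty 𝒜) : Prop :=
  ∀ ⦃B A : 𝒜⦄ (i : B ⟶ A), Mono i → ¬ IsIso i →
    ∃ (G : 𝒜) (_ : P G) (h : G ⟶ A), ¬ ∃ k : G ⟶ B, k ≫ i = h

end Entwined

/-! Everything is read off the functor `toFunctor` that forgets the coactions and lands in `Dᵒᵖ ⥤
ModuleCat K`, an abelian category in which filtered colimits are exact. A colimit of underlying
functors inherits a coaction from its universal property. A finite limit inherits one because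
tensoring over a field is exact, so that the limit tensored with `C` is again a limit
(`exists_coaction_of_isColimit`, `exists_coaction_of_isLimit`). The remaining axioms are equations
between linear maps natural in colinear maps, so they may be tested on the coprojections or
projections (`ofJointlyEpi`, `ofJointlyMono`). Hence `toFunctor` creates colimits and finite limits.
It also reflects isomorphisms, and so abelianness and AB5 descend from the functor category.

For generation, any `a` in `A(X)` lies in a finite-dimensional subcomodule `V`
(`RightCoaction.exists_finiteDimensional_mem`). As in the Yoneda lemma, the inclusion of `V` extends
to a morphism `V ⊗ h_X ⟶ A` sending `a ⊗ id` to `a`. The images of these morphisms therefore cover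
`A`, which gives both forms of generation. Choosing bases replaces `V` by some `Kⁿ`, leaving a set
of objects whose coproduct is a separator. -/

namespace Entwined

open Limits

variable {K : Type u} [Field K] {C : Type u} [AddCommGroup C] [Module K C] [Coalgebra K C]
  {D : Type u} [Category.{u} D] [Preadditive D] [Linear K D]

/-! ### Naturality of the two sides of each axiom -/

/-- The map `v ⊗ f ↦ v₀ ⊗ f_ψ ⊗ v₁^ψ` is natural in colinear maps. -/
theorem Entwining.rTensor_comp_twist (E : Entwining K C D) {V W : Type u} [AddCommGroup V]
    [Module K V] [AddCommGroup W] [Module K W] {ρ : V →ₗ[K] V ⊗[K] C} {σ : W →ₗ[K] W ⊗[K] C}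
    (φ : V →ₗ[K] W) (h : φ.rTensor C ∘ₗ ρ = σ ∘ₗ φ) (X Y : D) :
    (φ.rTensor (Y ⟶ X)).rTensor C ∘ₗ E.twist ρ X Y = E.twist σ X Y ∘ₗ φ.rTensor (Y ⟶ X) := by
  refine TensorProduct.ext' fun v f => ?_
  have h' : σ (φ v) = φ.rTensor C (ρ v) := (LinearMap.congr_fun h v).symm
  simp only [LinearMap.comp_apply, LinearMap.rTensor_tmul, E.twist_tmul, h']
  induction ρ v with
  | zero => simp
  | add a b ha hb => simp only [map_add, ha, hb]
  | tmul w c =>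
    simp only [LinearMap.lTensor_tmul, LinearMap.comp_apply, LinearMap.flip_apply,
      TensorProduct.mk_apply, LinearMap.rTensor_tmul]
    induction E.ψ Y X (c ⊗ₜ[K] f) with
    | zero => simp
    | add a b ha hb => simp only [TensorProduct.tmul_add, map_add, ha, hb]
    | tmul a b => simp

/-- The action is natural in morphisms of right modules. -/
theorem RightModule.comp_act {M N : RightModule K D} (α : M.F ⟶ N.F) (X Y : D) :
    (α.app (op Y)).hom ∘ₗ M.act X Y = N.act X Y ∘ₗ (α.app (op X)).hom.rTensor (Y ⟶ X) := by
  refine TensorProduct.ext' fun m f => ?_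
  exact LinearMap.congr_fun (congrArg ModuleCat.Hom.hom (α.naturality f.op)) m

/-- The diagonal coaction of `M(X) ⊗ Hom(Y, X)` followed by the action. -/
def Entwining.twistAct (E : Entwining K C D) (M : RightModule K D) (X Y : D)
    (ρ : M.F.obj (op X) →ₗ[K] M.F.obj (op X) ⊗[K] C) :
    M.F.obj (op X) ⊗[K] (Y ⟶ X) →ₗ[K] M.F.obj (op Y) ⊗[K] C :=
  (M.act X Y).rTensor C ∘ₗ E.twist ρ X Y

theorem Entwining.rTensor_comp_twistAct (E : Entwining K C D) {M N : RightModule K D}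
    (α : M.F ⟶ N.F) (X Y : D)
    {ρ : M.F.obj (op X) →ₗ[K] M.F.obj (op X) ⊗[K] C}
    {σ : N.F.obj (op X) →ₗ[K] N.F.obj (op X) ⊗[K] C}
    (h : (α.app (op X)).hom.rTensor C ∘ₗ ρ = σ ∘ₗ (α.app (op X)).hom) :
    (α.app (op Y)).hom.rTensor C ∘ₗ E.twistAct M X Y ρ =
      E.twistAct N X Y σ ∘ₗ (α.app (op X)).hom.rTensor (Y ⟶ X) := by
  rw [Entwining.twistAct, Entwining.twistAct, ← LinearMap.comp_assoc, ← LinearMap.rTensor_comp,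
    RightModule.comp_act, LinearMap.rTensor_comp, LinearMap.comp_assoc, E.rTensor_comp_twist _ h,
    LinearMap.comp_assoc]

/-- This and the two lemmas after it move the sides of the comodule axioms across a colinear map, so
that an axiom known at one end can be tested at the other. -/
theorem rTensor_comp_coassoc_left {K C V W : Type u} [Field K] [AddCommGroup C] [Module K C]
    [AddCommGroup V] [Module K V] [AddCommGroup W] [Module K W] {ρ : V →ₗ[K] V ⊗[K] C}
    {σ : W →ₗ[K] W ⊗[K] C} (φ : V →ₗ[K] W) (h : φ.rTensor C ∘ₗ ρ = σ ∘ₗ φ) :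
    φ.rTensor (C ⊗[K] C) ∘ₗ (TensorProduct.assoc K V C C).toLinearMap ∘ₗ ρ.rTensor C ∘ₗ ρ =
      ((TensorProduct.assoc K W C C).toLinearMap ∘ₗ σ.rTensor C ∘ₗ σ) ∘ₗ φ := by
  have h1 : φ.rTensor (C ⊗[K] C) ∘ₗ (TensorProduct.assoc K V C C).toLinearMap =
      (TensorProduct.assoc K W C C).toLinearMap ∘ₗ (φ.rTensor C).rTensor C :=
    TensorProduct.ext_threefold fun _ _ _ => rfl
  rw [← LinearMap.comp_assoc, h1]
  simp only [LinearMap.comp_assoc, ← h]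
  have h2 : (φ.rTensor C).rTensor C ∘ₗ ρ.rTensor C = σ.rTensor C ∘ₗ φ.rTensor C := by
    rw [← LinearMap.rTensor_comp, h, LinearMap.rTensor_comp]
  rw [← LinearMap.comp_assoc ρ, h2, LinearMap.comp_assoc]

section Coassociativity

variable {V W : Type u} [AddCommGroup V] [Module K V] [AddCommGroup W] [Module K W]
  {ρ : V →ₗ[K] V ⊗[K] C} {σ : W →ₗ[K] W ⊗[K] C} (φ : V →ₗ[K] W)

theorem rTensor_comp_coassoc_right (h : φ.rTensor C ∘ₗ ρ = σ ∘ₗ φ) :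
    φ.rTensor (C ⊗[K] C) ∘ₗ (Coalgebra.comul (R := K) (A := C)).lTensor V ∘ₗ ρ =
      ((Coalgebra.comul (R := K) (A := C)).lTensor W ∘ₗ σ) ∘ₗ φ := by
  rw [← LinearMap.comp_assoc, LinearMap.rTensor_comp_lTensor, LinearMap.comp_assoc, ← h,
    ← LinearMap.comp_assoc, LinearMap.lTensor_comp_rTensor]

theorem comp_counit (h : φ.rTensor C ∘ₗ ρ = σ ∘ₗ φ) :
    φ ∘ₗ (TensorProduct.rid K V).toLinearMap ∘ₗ
        (Coalgebra.counit (R := K) (A := C)).lTensor V ∘ₗ ρ =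
      ((TensorProduct.rid K W).toLinearMap ∘ₗ
        (Coalgebra.counit (R := K) (A := C)).lTensor W ∘ₗ σ) ∘ₗ φ := by
  have h1 : φ ∘ₗ (TensorProduct.rid K V).toLinearMap ∘ₗ
        (Coalgebra.counit (R := K) (A := C)).lTensor V =
      (TensorProduct.rid K W).toLinearMap ∘ₗ
        (Coalgebra.counit (R := K) (A := C)).lTensor W ∘ₗ φ.rTensor C :=
    TensorProduct.ext' fun _ _ => by simp
  rw [LinearMap.comp_assoc, LinearMap.comp_assoc, ← h]
  exact congrArg (· ∘ₗ ρ) h1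

end Coassociativity

/-! ### Comodule structures detected by joint families -/

/-- A family of linear maps into `V` is jointly epimorphic. -/
def JointlyEpi {J : Type*} {M : J → Type u} {V : Type u} [∀ j, AddCommGroup (M j)]
    [∀ j, Module K (M j)] [AddCommGroup V] [Module K V] (ι : ∀ j, M j →ₗ[K] V) : Prop :=
  ∀ ⦃W : Type u⦄ [AddCommGroup W] [Module K W] (a b : V →ₗ[K] W),
    (∀ j, a ∘ₗ ι j = b ∘ₗ ι j) → a = b

/-- A family of linear maps out of `V` stays jointly injective after tensoring with any space. -/
def JointlyMono {J : Type*} {M : J → Type u} {V : Type u} [∀ j, AddCommGroup (M j)]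
    [∀ j, Module K (M j)] [AddCommGroup V] [Module K V] (π : ∀ j, V →ₗ[K] M j) : Prop :=
  ∀ ⦃U W : Type u⦄ [AddCommGroup U] [Module K U] [AddCommGroup W] [Module K W]
    (a b : U →ₗ[K] V ⊗[K] W),
    (∀ j, (π j).rTensor W ∘ₗ a = (π j).rTensor W ∘ₗ b) → a = b

section

variable {J : Type*} {M : J → Type u} {V : Type u} [∀ j, AddCommGroup (M j)]
    [∀ j, Module K (M j)] [AddCommGroup V] [Module K V]

/-- By currying, a map out of `V ⊗ H` is a map from `V` to `Hom(H, W)`. This is why `JointlyEpi`,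
unlike `JointlyMono`, need not mention tensor products. -/
theorem JointlyEpi.rTensor {ι : ∀ j, M j →ₗ[K] V} (h : JointlyEpi ι) {H W : Type u}
    [AddCommGroup H] [Module K H] [AddCommGroup W] [Module K W] {a b : V ⊗[K] H →ₗ[K] W}
    (hab : ∀ j, a ∘ₗ (ι j).rTensor H = b ∘ₗ (ι j).rTensor H) : a = b := by
  refine TensorProduct.ext (h _ _ fun j => ?_)
  ext m f
  exact LinearMap.congr_fun (hab j) (m ⊗ₜ f)

/-- The case `W = K` of the definition, through `V ≅ V ⊗ K`. -/
theorem JointlyMono.cancel {π : ∀ j, V →ₗ[K] M j} (h : JointlyMono π) {U : Type u}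
    [AddCommGroup U] [Module K U] {a b : U →ₗ[K] V}
    (hab : ∀ j, π j ∘ₗ a = π j ∘ₗ b) : a = b := by
  have key := h ((TensorProduct.rid K V).symm.toLinearMap ∘ₗ a)
    ((TensorProduct.rid K V).symm.toLinearMap ∘ₗ b) fun j => by
      ext x
      simpa using congrArg (fun t => t ⊗ₜ[K] (1 : K)) (LinearMap.congr_fun (hab j) x)
  ext x
  exact (TensorProduct.rid K V).symm.injective (LinearMap.congr_fun key x)

/-- The target of a jointly epimorphic family of colinear maps is a comodule. -/
def RightCoaction.ofJointlyEpi (δ : ∀ j, RightCoaction K C (M j)) {ι : ∀ j, M j →ₗ[K] V}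
    (h : JointlyEpi ι) (ρ : V →ₗ[K] V ⊗[K] C)
    (hρ : ∀ j, (ι j).rTensor C ∘ₗ (δ j).ρ = ρ ∘ₗ ι j) : RightCoaction K C V where
  ρ := ρ
  coassoc := h _ _ fun j => by
    rw [← rTensor_comp_coassoc_left _ (hρ j), ← rTensor_comp_coassoc_right _ (hρ j),
      (δ j).coassoc]
  counit := h _ _ fun j => by
    rw [← comp_counit _ (hρ j), (δ j).counit, LinearMap.comp_id, LinearMap.id_comp]

/-- The source of a jointly monomorphic family of colinear maps is a comodule. -/
def RightCoaction.ofJointlyMono (δ : ∀ j, RightCoaction K C (M j)) {π : ∀ j, V →ₗ[K] M j}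
    (h : JointlyMono π) (ρ : V →ₗ[K] V ⊗[K] C)
    (hρ : ∀ j, (π j).rTensor C ∘ₗ ρ = (δ j).ρ ∘ₗ π j) : RightCoaction K C V where
  ρ := ρ
  coassoc := h _ _ fun j => by
    rw [rTensor_comp_coassoc_left _ (hρ j), rTensor_comp_coassoc_right _ (hρ j),
      (δ j).coassoc]
  counit := h.cancel fun j => by
    rw [comp_counit _ (hρ j), (δ j).counit, LinearMap.comp_id, LinearMap.id_comp]

end

/-! ### Entwined modules detected by joint families -/

namespace EntwinedModule

variable {E : Entwining K C D}

section JointlyEpi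

variable {F : Dᵒᵖ ⥤ ModuleCat.{u} K} {J : Type*} (M : J → EntwinedModule E)
  (ι : ∀ j, (M j).F ⟶ F)

/-- A functor with a jointly epimorphic family of maps from right modules is a right module. -/
def rightModuleOfJointlyEpi
    (h : ∀ X : D, JointlyEpi fun j => ((ι j).app (op X)).hom) : RightModule K D where
  F := F
  map_add {X Y} f g := by
    ext : 1
    refine h X _ _ fun j => ?_
    simp only [← ModuleCat.hom_comp]
    rw [← (ι j).naturality, (M j).map_add, Preadditive.comp_add, Preadditive.add_comp,
      (ι j).naturality, (ι j).naturality]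
  map_smul {X Y} r f := by
    ext : 1
    refine h X _ _ fun j => ?_
    simp only [← ModuleCat.hom_comp]
    rw [← (ι j).naturality, (M j).map_smul, Linear.comp_smul, Linear.smul_comp,
      (ι j).naturality]

theorem compat_of_jointlyEpi {P : RightModule K D} (ι : ∀ j, (M j).F ⟶ P.F)
    (h : ∀ X : D, JointlyEpi fun j => ((ι j).app (op X)).hom)
    (ρ : ∀ X : D, P.F.obj (op X) →ₗ[K] P.F.obj (op X) ⊗[K] C)
    (hρ : ∀ (X : D) (j : J), ((ι j).app (op X)).hom.rTensor C ∘ₗ ((M j).coact X).ρ =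
      ρ X ∘ₗ ((ι j).app (op X)).hom) (X Y : D) :
    ρ Y ∘ₗ P.act X Y = E.twistAct P X Y (ρ X) := by
  refine (h X).rTensor fun j => ?_
  rw [← E.rTensor_comp_twistAct (M := (M j).toRightModule) (ι j) X Y (hρ X j),
    LinearMap.comp_assoc, ← RightModule.comp_act, ← LinearMap.comp_assoc, ← hρ,
    LinearMap.comp_assoc, (M j).compat]
  rfl

/-- A functor with a jointly epimorphic family of maps from entwined modules, and compatible
coactions, is an entwined module. -/
def ofJointlyEpi (h : ∀ X : D, JointlyEpi fun j => ((ι j).app (op X)).hom)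
    (ρ : ∀ X : D, F.obj (op X) →ₗ[K] F.obj (op X) ⊗[K] C)
    (hρ : ∀ (X : D) (j : J), ((ι j).app (op X)).hom.rTensor C ∘ₗ ((M j).coact X).ρ =
      ρ X ∘ₗ ((ι j).app (op X)).hom) : EntwinedModule E where
  toRightModule := rightModuleOfJointlyEpi M ι h
  coact X := RightCoaction.ofJointlyEpi (fun j => (M j).coact X) (h X) (ρ X) (hρ X)
  compat := compat_of_jointlyEpi M (P := rightModuleOfJointlyEpi M ι h) ι h ρ hρ

end JointlyEpi

section JointlyMono

variable {F : Dᵒᵖ ⥤ ModuleCat.{u} K} {J : Type*} (M : J → EntwinedModule E)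
  (π : ∀ j, F ⟶ (M j).F)

/-- A functor with a jointly monomorphic family of maps to right modules is a right module. -/
def rightModuleOfJointlyMono
    (h : ∀ X : D, JointlyMono fun j => ((π j).app (op X)).hom) : RightModule K D where
  F := F
  map_add {X Y} f g := by
    ext : 1
    refine (h Y).cancel fun j => ?_
    simp only [← ModuleCat.hom_comp]
    rw [(π j).naturality, (M j).map_add, Preadditive.comp_add, Preadditive.add_comp,
      (π j).naturality, (π j).naturality]
  map_smul {X Y} r f := by
    ext : 1
    refine (h Y).cancel fun j => ?_
    simp only [← ModuleCat.hom_comp]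
    rw [(π j).naturality, (M j).map_smul, Linear.comp_smul, Linear.smul_comp,
      (π j).naturality]

/-- The identity takes values in `P(Y) ⊗ C`, so the projections must remain jointly injective after
tensoring with `C`. -/
theorem compat_of_jointlyMono {P : RightModule K D} (π : ∀ j, P.F ⟶ (M j).F)
    (h : ∀ X : D, JointlyMono fun j => ((π j).app (op X)).hom)
    (ρ : ∀ X : D, P.F.obj (op X) →ₗ[K] P.F.obj (op X) ⊗[K] C)
    (hρ : ∀ (X : D) (j : J), ((π j).app (op X)).hom.rTensor C ∘ₗ ρ X =
      ((M j).coact X).ρ ∘ₗ ((π j).app (op X)).hom) (X Y : D) :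
    ρ Y ∘ₗ P.act X Y = E.twistAct P X Y (ρ X) := by
  refine h Y _ _ fun j => ?_
  rw [E.rTensor_comp_twistAct (N := (M j).toRightModule) (π j) X Y (hρ X j),
    ← LinearMap.comp_assoc, hρ, LinearMap.comp_assoc, RightModule.comp_act,
    ← LinearMap.comp_assoc, (M j).compat]
  rfl

/-- A functor with a jointly monomorphic family of maps to entwined modules, and compatible
coactions, is an entwined module. -/
def ofJointlyMono (h : ∀ X : D, JointlyMono fun j => ((π j).app (op X)).hom)
    (ρ : ∀ X : D, F.obj (op X) →ₗ[K] F.obj (op X) ⊗[K] C)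
    (hρ : ∀ (X : D) (j : J), ((π j).app (op X)).hom.rTensor C ∘ₗ ρ X =
      ((M j).coact X).ρ ∘ₗ ((π j).app (op X)).hom) : EntwinedModule E where
  toRightModule := rightModuleOfJointlyMono M π h
  coact X := RightCoaction.ofJointlyMono (fun j => (M j).coact X) (h X) (ρ X) (hρ X)
  compat := compat_of_jointlyMono M (P := rightModuleOfJointlyMono M π h) π h ρ hρ

end JointlyMono

/-! ### The forgetful functor and colinearity of induced maps -/

variable (E) in
/-- The functor that forgets the coactions. -/
@[simps]
def toFunctor : EntwinedModule E ⥤ Dᵒᵖ ⥤ ModuleCat.{u} K where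
  obj M := M.F
  map f := f.nat

instance : (toFunctor E).Faithful where
  map_injective h := hom_ext h

instance : (toFunctor E).Additive where
  map_add := rfl

/-- The inverse of a colinear bijection is colinear: insert `f ∘ f⁻¹` before the coaction of the
target and move `f` across. -/
instance : (toFunctor E).ReflectsIsomorphisms where
  reflects {M N} f hf := by
    have : IsIso f.nat := hf
    refine ⟨⟨⟨inv f.nat, fun X => ?_⟩, hom_ext (IsIso.hom_inv_id f.nat),
      hom_ext (IsIso.inv_hom_id f.nat)⟩⟩
    have h1 : ((inv f.nat).app (op X)).hom ∘ₗ (f.nat.app (op X)).hom = LinearMap.id := by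
      rw [← ModuleCat.hom_comp, ← NatTrans.comp_app, IsIso.hom_inv_id]
      rfl
    have h2 : (f.nat.app (op X)).hom ∘ₗ ((inv f.nat).app (op X)).hom = LinearMap.id := by
      rw [← ModuleCat.hom_comp, ← NatTrans.comp_app, IsIso.inv_hom_id]
      rfl
    calc
      _ = ((inv f.nat).app (op X)).hom.rTensor C ∘ₗ ((N.coact X).ρ ∘ₗ (f.nat.app (op X)).hom) ∘ₗ
            ((inv f.nat).app (op X)).hom := by rw [LinearMap.comp_assoc, h2, LinearMap.comp_id]
      _ = _ := by
        rw [← f.colinear, LinearMap.comp_assoc, ← LinearMap.comp_assoc, ← LinearMap.rTensor_comp,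
          h1, LinearMap.rTensor_id, LinearMap.id_comp]

theorem colinear_of_jointlyEpi {J : Type*} {L : J → EntwinedModule E} {M N : EntwinedModule E}
    (ι : ∀ j, L j ⟶ M) (g : ∀ j, L j ⟶ N) (f : M.F ⟶ N.F) (X : D)
    (h : JointlyEpi fun j => ((ι j).nat.app (op X)).hom) (hf : ∀ j, (ι j).nat ≫ f = (g j).nat) :
    (f.app (op X)).hom.rTensor C ∘ₗ (M.coact X).ρ = (N.coact X).ρ ∘ₗ (f.app (op X)).hom := by
  refine h _ _ fun j => ?_
  have h1 : (f.app (op X)).hom ∘ₗ ((ι j).nat.app (op X)).hom = ((g j).nat.app (op X)).hom := by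
    rw [← hf]
    rfl
  rw [LinearMap.comp_assoc, LinearMap.comp_assoc, h1, ← (ι j).colinear, ← LinearMap.comp_assoc,
    ← LinearMap.rTensor_comp, h1, (g j).colinear]

theorem colinear_of_jointlyMono {J : Type*} {L : J → EntwinedModule E} {M N : EntwinedModule E}
    (π : ∀ j, N ⟶ L j) (g : ∀ j, M ⟶ L j) (f : M.F ⟶ N.F) (X : D)
    (h : JointlyMono fun j => ((π j).nat.app (op X)).hom) (hf : ∀ j, f ≫ (π j).nat = (g j).nat) :
    (f.app (op X)).hom.rTensor C ∘ₗ (M.coact X).ρ = (N.coact X).ρ ∘ₗ (f.app (op X)).hom := by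
  refine h _ _ fun j => ?_
  have h1 : ((π j).nat.app (op X)).hom ∘ₗ (f.app (op X)).hom = ((g j).nat.app (op X)).hom := by
    rw [← hf]
    rfl
  rw [← LinearMap.comp_assoc, ← LinearMap.comp_assoc, ← LinearMap.rTensor_comp, h1,
    (π j).colinear, LinearMap.comp_assoc, h1, (g j).colinear]

/-! ### Creation of colimits -/

section Colimits

variable {J : Type u} [Category.{u} J] {G : J ⥤ EntwinedModule E} {c : Cocone (G ⋙ toFunctor E)}

/-- The maps of a cocone over the underlying functors. -/
def coconeNat (c : Cocone (G ⋙ toFunctor E)) (j : J) : (G.obj j).F ⟶ c.pt := c.ι.app j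

theorem coconeNat_w (c : Cocone (G ⋙ toFunctor E)) {i j : J} (f : i ⟶ j) :
    (G.map f).nat ≫ coconeNat c j = coconeNat c i := c.w f

theorem jointlyEpi_of_isColimit (hc : IsColimit c) (X : D) :
    JointlyEpi fun j => ((coconeNat c j).app (op X)).hom := by
  intro W _ _ a b hab
  have hcX := isColimitOfPreserves ((evaluation _ _).obj (op X)) hc
  have : ModuleCat.ofHom a = ModuleCat.ofHom b :=
    hcX.hom_ext fun j => ModuleCat.hom_ext (hab j)
  exact congrArg ModuleCat.Hom.hom this

/-- Colinearity of the transition maps makes the coactions, followed by the coprojections tensored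
with `C`, a cocone; the coaction is the map it induces. No exactness is needed. -/
theorem exists_coaction_of_isColimit (hc : IsColimit c) (X : D) :
    ∃ ρ : c.pt.obj (op X) →ₗ[K] c.pt.obj (op X) ⊗[K] C,
      ∀ j, ((coconeNat c j).app (op X)).hom.rTensor C ∘ₗ ((G.obj j).coact X).ρ =
        ρ ∘ₗ ((coconeNat c j).app (op X)).hom := by
  have hcX := isColimitOfPreserves ((evaluation _ _).obj (op X)) hc
  let s : Cocone ((G ⋙ toFunctor E) ⋙ (evaluation _ _).obj (op X)) :=
    { pt := ModuleCat.of K (c.pt.obj (op X) ⊗[K] C)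
      ι :=
        { app := fun j => ModuleCat.ofHom
            (((coconeNat c j).app (op X)).hom.rTensor C ∘ₗ ((G.obj j).coact X).ρ)
          naturality := fun i j f => by
            ext : 1
            change (((coconeNat c j).app (op X)).hom.rTensor C ∘ₗ ((G.obj j).coact X).ρ) ∘ₗ
              ((G.map f).nat.app (op X)).hom =
              ((coconeNat c i).app (op X)).hom.rTensor C ∘ₗ ((G.obj i).coact X).ρ
            rw [LinearMap.comp_assoc, ← (G.map f).colinear, ← LinearMap.comp_assoc,
              ← LinearMap.rTensor_comp, ← coconeNat_w c f]
            rfl } }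
  refine ⟨(hcX.desc s).hom, fun j => ?_⟩
  exact (congrArg ModuleCat.Hom.hom (hcX.fac s j)).symm

/-- A cocone of entwined modules on a colimit of the underlying functors. -/
noncomputable def liftedCocone (hc : IsColimit c) : Cocone G where
  pt := ofJointlyEpi G.obj (coconeNat c) (jointlyEpi_of_isColimit hc) _
    fun X => (exists_coaction_of_isColimit hc X).choose_spec
  ι :=
    { app := fun j => ⟨coconeNat c j, fun X => (exists_coaction_of_isColimit hc X).choose_spec j⟩
      naturality := fun _ _ f => hom_ext (c.ι.naturality f) }

/-- A colimit of the underlying functors carries a colimit of entwined modules. -/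
noncomputable def liftsToColimit (G : J ⥤ EntwinedModule E) (c : Cocone (G ⋙ toFunctor E))
    (hc : IsColimit c) : LiftsToColimit G (toFunctor E) c hc where
  liftedCocone := liftedCocone hc
  validLift := Iso.refl _
  makesColimit :=
    { desc := fun s => ⟨hc.desc ((toFunctor E).mapCocone s), fun X =>
        colinear_of_jointlyEpi (M := (liftedCocone hc).pt) (liftedCocone hc).ι.app s.ι.app _ X
          (jointlyEpi_of_isColimit hc X) (hc.fac ((toFunctor E).mapCocone s))⟩
      fac := fun s j => hom_ext (hc.fac ((toFunctor E).mapCocone s) j)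
      uniq := fun s m hm => hom_ext (hc.uniq ((toFunctor E).mapCocone s) m.nat
        fun j => congrArg Hom.nat (hm j)) }

noncomputable instance : CreatesColimits.{u} (toFunctor E) where
  CreatesColimitsOfShape := { CreatesColimit := createsColimitOfReflectsIso (liftsToColimit _) }

end Colimits

/-! ### Creation of finite limits -/

section FiniteLimits

variable {J : Type} [SmallCategory J] {G : J ⥤ EntwinedModule E} {c : Cone (G ⋙ toFunctor E)}

/-- The maps of a cone over the underlying functors. -/
def coneNat (c : Cone (G ⋙ toFunctor E)) (j : J) : c.pt ⟶ (G.obj j).F := c.π.app j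

theorem coneNat_w (c : Cone (G ⋙ toFunctor E)) {i j : J} (f : i ⟶ j) :
    coneNat c i ≫ (G.map f).nat = coneNat c j := c.w f

variable [FinCategory J]

/-- Tensoring the value at `X` with a vector space preserves finite limits. -/
noncomputable def isLimitTensor (hc : IsLimit c) (X : D) (W : Type u) [AddCommGroup W]
    [Module K W] : IsLimit ((MonoidalCategory.tensorRight (ModuleCat.of K W)).mapCone
      (((evaluation _ _).obj (op X)).mapCone c)) :=
  isLimitOfPreserves _ (isLimitOfPreserves ((evaluation _ _).obj (op X)) hc)

theorem jointlyMono_of_isLimit (hc : IsLimit c) (X : D) :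
    JointlyMono fun j => ((coneNat c j).app (op X)).hom := by
  intro U W _ _ _ _ a b hab
  have : ModuleCat.ofHom (Y := (MonoidalCategory.tensorRight (ModuleCat.of K W)).obj
      (c.pt.obj (op X))) a = ModuleCat.ofHom b :=
    (isLimitTensor hc X W).hom_ext fun j => ModuleCat.hom_ext (hab j)
  exact congrArg ModuleCat.Hom.hom this

/-- Dual to the colimit case, but the induced map must land in limit `⊗ C`; `isLimitTensor` makes
that the limit of the tensored diagram, which restricts the argument to finite shapes. -/
theorem exists_coaction_of_isLimit (hc : IsLimit c) (X : D) :
    ∃ ρ : c.pt.obj (op X) →ₗ[K] c.pt.obj (op X) ⊗[K] C,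
      ∀ j, ((coneNat c j).app (op X)).hom.rTensor C ∘ₗ ρ =
        ((G.obj j).coact X).ρ ∘ₗ ((coneNat c j).app (op X)).hom := by
  let s : Cone (((G ⋙ toFunctor E) ⋙ (evaluation _ _).obj (op X)) ⋙
      MonoidalCategory.tensorRight (ModuleCat.of K C)) :=
    { pt := c.pt.obj (op X)
      π :=
        { app := fun j => ModuleCat.ofHom
            (((G.obj j).coact X).ρ ∘ₗ ((coneNat c j).app (op X)).hom)
          naturality := fun i j f => by
            ext : 1
            change ((G.obj j).coact X).ρ ∘ₗ ((coneNat c j).app (op X)).hom =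
              ((G.map f).nat.app (op X)).hom.rTensor C ∘ₗ
                ((G.obj i).coact X).ρ ∘ₗ ((coneNat c i).app (op X)).hom
            rw [← LinearMap.comp_assoc, (G.map f).colinear, ← coneNat_w c f]
            rfl } }
  refine ⟨((isLimitTensor hc X C).lift s).hom, fun j => ?_⟩
  exact congrArg ModuleCat.Hom.hom ((isLimitTensor hc X C).fac s j)

/-- A cone of entwined modules on a finite limit of the underlying functors. -/
noncomputable def liftedCone (hc : IsLimit c) : Cone G where
  pt := ofJointlyMono G.obj (coneNat c) (jointlyMono_of_isLimit hc) _
    fun X => (exists_coaction_of_isLimit hc X).choose_spec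
  π :=
    { app := fun j => ⟨coneNat c j, fun X => (exists_coaction_of_isLimit hc X).choose_spec j⟩
      naturality := fun _ _ f => hom_ext (c.π.naturality f) }

/-- A finite limit of the underlying functors carries a limit of entwined modules. -/
noncomputable def liftsToLimit (G : J ⥤ EntwinedModule E) (c : Cone (G ⋙ toFunctor E))
    (hc : IsLimit c) : LiftsToLimit G (toFunctor E) c hc where
  liftedCone := liftedCone hc
  validLift := Iso.refl _
  makesLimit :=
    { lift := fun s => ⟨hc.lift ((toFunctor E).mapCone s), fun X =>
        colinear_of_jointlyMono (N := (liftedCone hc).pt) (liftedCone hc).π.app s.π.app _ X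
          (jointlyMono_of_isLimit hc X) (hc.fac ((toFunctor E).mapCone s))⟩
      fac := fun s j => hom_ext (hc.fac ((toFunctor E).mapCone s) j)
      uniq := fun s m hm => hom_ext (hc.uniq ((toFunctor E).mapCone s) m.nat
        fun j => congrArg Hom.nat (hm j)) }

noncomputable instance : CreatesLimitsOfShape J (toFunctor E) where
  CreatesLimit := createsLimitOfReflectsIso (liftsToLimit _)

end FiniteLimits

/-! ### Abelianness and AB5 -/

instance : HasColimits (EntwinedModule E) :=
  hasColimits_of_hasColimits_createsColimits (toFunctor E)

instance : HasFiniteLimits (EntwinedModule E) where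
  out _ _ _ := hasLimitsOfShape_of_hasLimitsOfShape_createsLimitsOfShape (toFunctor E)

instance : PreservesFiniteLimits (toFunctor E) where
  preservesFiniteLimits _ _ _ := inferInstance

instance : HasFiniteColimits (EntwinedModule E) := hasFiniteColimits_of_hasColimits _

instance : PreservesFiniteColimits (toFunctor E) :=
  PreservesColimits.preservesFiniteColimits (toFunctor E)

/-- An exact functor carries the comparison map to the comparison map of the image, which is
invertible in the abelian functor category; then reflect. -/
instance {M N : EntwinedModule E} (f : M ⟶ N) : IsIso (Abelian.coimageImageComparison f) := by
  have : IsIso ((toFunctor E).map (Abelian.coimageImageComparison f)) :=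
    ((MorphismProperty.isomorphisms _).arrow_mk_iso_iff
      (Abelian.PreservesCoimageImageComparison.iso (toFunctor E) f)).2
      (inferInstanceAs (IsIso _))
  exact isIso_of_reflects_iso _ (toFunctor E)

variable (E) in
/-- The category of entwined modules is abelian. -/
@[reducible]
noncomputable def abelian : Abelian (EntwinedModule E) := .ofCoimageImageComparisonIsIso

instance : AB5 (EntwinedModule E) where
  ofShape J _ _ :=
    have : ReflectsFiniteLimits (toFunctor E) := ⟨fun _ _ _ => inferInstance⟩
    HasExactColimitsOfShape.domain_of_functor J (toFunctor E)

end EntwinedModule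

/-! ### Local finiteness of comodules -/

section Subcomodules

variable {V W : Type u} [AddCommGroup V] [Module K V] [AddCommGroup W] [Module K W]

theorem jointlyMono_of_injective {π : V →ₗ[K] W} (h : Function.Injective π) :
    JointlyMono fun _ : Unit => π := by
  intro U Z _ _ _ _ a b hab
  ext x
  exact Module.Flat.rTensor_preserves_injective_linearMap π h (LinearMap.congr_fun (hab ()) x)

/-- Contraction of the right factor of `V ⊗ Z` with a functional on `Z`. -/
noncomputable def contract (V : Type u) [AddCommGroup V] [Module K V] {Z : Type u}
    [AddCommGroup Z] [Module K Z] (φ : Module.Dual K Z) : V ⊗[K] Z →ₗ[K] V :=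
  (TensorProduct.rid K V).toLinearMap ∘ₗ φ.lTensor V

@[simp]
theorem contract_tmul {Z : Type u} [AddCommGroup Z] [Module K Z] (φ : Module.Dual K Z) (v : V)
    (z : Z) : contract V φ (v ⊗ₜ[K] z) = φ z • v := by
  simp [contract]

/-- A tensor all of whose contractions lie in the subspace `p` comes from `p ⊗ Z`. -/
theorem mem_range_rTensor_subtype_of_contract_mem {Z : Type u} [AddCommGroup Z] [Module K Z]
    (p : Submodule K V) (t : V ⊗[K] Z) (h : ∀ φ : Module.Dual K Z, contract V φ t ∈ p) :
    t ∈ LinearMap.range (p.subtype.rTensor Z) := by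
  classical
  let b := Module.Basis.ofVectorSpace K Z
  rw [← (TensorProduct.equivFinsuppOfBasisRight (M := V) b).symm_apply_apply t,
    TensorProduct.equivFinsuppOfBasisRight_symm_apply]
  refine Submodule.sum_mem _ fun i _ => ?_
  rw [TensorProduct.equivFinsuppOfBasisRight_apply]
  -- The coefficient of `t` at `b i` is its contraction with the coordinate functional, hence lies
  -- in `p`.
  exact ⟨(⟨_, h (b.coord i)⟩ : p) ⊗ₜ b i, rfl⟩

theorem exists_finiteDimensional_contract_mem {Z : Type u} [AddCommGroup Z] [Module K Z]
    (t : V ⊗[K] Z) : ∃ q : Submodule K V, FiniteDimensional K q ∧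
      ∀ φ : Module.Dual K Z, contract V φ t ∈ q := by
  induction t with
  | zero => exact ⟨⊥, inferInstance, fun φ => by simp⟩
  | tmul v z =>
    exact ⟨K ∙ v, inferInstance, fun φ => by
      rw [contract_tmul]
      exact Submodule.smul_mem _ _ (Submodule.mem_span_singleton_self v)⟩
  | add a b ha hb =>
    obtain ⟨q, hq, ha⟩ := ha
    obtain ⟨r, hr, hb⟩ := hb
    refine ⟨q ⊔ r, inferInstance, fun φ => ?_⟩
    rw [map_add]
    exact Submodule.add_mem_sup (ha φ) (hb φ)

theorem contract_comp_contract {C : Type u} [AddCommGroup C] [Module K C] (ρ : V →ₗ[K] V ⊗[K] C) (χ φ : Module.Dual K C) (t : V ⊗[K] C) :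
    contract V χ (ρ (contract V φ t)) =
      contract V ((TensorProduct.lid K K).toLinearMap ∘ₗ TensorProduct.map χ φ)
        (TensorProduct.assoc K V C C (ρ.rTensor C t)) := by
  induction t with
  | zero => simp
  | add a b ha hb => simp only [map_add, ha, hb]
  | tmul w c =>
    simp only [contract_tmul, map_smul, LinearMap.rTensor_tmul]
    induction ρ w with
    | zero => simp
    | add a b ha hb => simp only [TensorProduct.add_tmul, map_add, smul_add, ha, hb]
    | tmul x d => simp [smul_smul, mul_comm]

/-- Every element of a comodule lies in a finite-dimensional subcomodule. -/
theorem RightCoaction.exists_finiteDimensional_mem (δ : RightCoaction K C V) (a : V) :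
    ∃ p : Submodule K V, FiniteDimensional K p ∧ a ∈ p ∧
      ∀ v ∈ p, δ.ρ v ∈ LinearMap.range (p.subtype.rTensor C) := by
  -- The range of `T` is the orbit of `a` under the dual `C*`. It is finite-dimensional because
  -- `ρ(a)` is a finite sum of pure tensors.
  let T : Module.Dual K C →ₗ[K] V :=
    { toFun := fun φ => contract V φ (δ.ρ a)
      map_add' := fun φ χ => by simp [contract, LinearMap.lTensor_add]
      map_smul' := fun r φ => by simp [contract, LinearMap.lTensor_smul] }
  refine ⟨LinearMap.range T, ?_, ?_, ?_⟩
  · obtain ⟨q, hq, h⟩ := exists_finiteDimensional_contract_mem (δ.ρ a)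
    refine Submodule.finiteDimensional_of_le (S₂ := q) ?_
    rintro _ ⟨φ, rfl⟩
    exact h φ
  · exact ⟨Coalgebra.counit, LinearMap.congr_fun δ.counit a⟩
  · rintro _ ⟨φ, rfl⟩
    refine mem_range_rTensor_subtype_of_contract_mem _ _ fun χ => ?_
    -- The witness is the convolution product of `χ` and `φ`; coassociativity says that contracting
    -- twice is contracting with it.
    refine ⟨((TensorProduct.lid K K).toLinearMap ∘ₗ TensorProduct.map χ φ) ∘ₗ Coalgebra.comul, ?_⟩
    change _ = contract V χ (δ.ρ (contract V φ (δ.ρ a)))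
    rw [contract_comp_contract]
    refine Eq.trans ?_ (congrArg (contract V _) (LinearMap.congr_fun δ.coassoc a).symm)
    change contract V _ (δ.ρ a) = contract V _ (Coalgebra.comul.lTensor V (δ.ρ a))
    simp only [contract, LinearMap.comp_apply, LinearMap.lTensor_comp]

/-- The coaction on a subcomodule. -/
theorem RightCoaction.exists_restrict (δ : RightCoaction K C V) (p : Submodule K V)
    (hp : ∀ v ∈ p, δ.ρ v ∈ LinearMap.range (p.subtype.rTensor C)) :
    ∃ δ' : RightCoaction K C p, p.subtype.rTensor C ∘ₗ δ'.ρ = δ.ρ ∘ₗ p.subtype := by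
  have hinj : Function.Injective (p.subtype.rTensor C) :=
    Module.Flat.rTensor_preserves_injective_linearMap _ p.injective_subtype
  let ρ : p →ₗ[K] p ⊗[K] C := (LinearEquiv.ofInjective _ hinj).symm.toLinearMap ∘ₗ
    (δ.ρ ∘ₗ p.subtype).codRestrict _ fun v => hp v v.2
  have hρ : p.subtype.rTensor C ∘ₗ ρ = δ.ρ ∘ₗ p.subtype := by
    ext v
    exact congrArg Subtype.val ((LinearEquiv.ofInjective _ hinj).apply_symm_apply _)
  exact ⟨.ofJointlyMono (fun _ => δ) (jointlyMono_of_injective p.injective_subtype) ρ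
    fun _ => hρ, hρ⟩

/-- Transport of a coaction along a linear equivalence. -/
theorem RightCoaction.exists_transport (δ : RightCoaction K C V) (e : W ≃ₗ[K] V) :
    ∃ δ' : RightCoaction K C W, e.toLinearMap.rTensor C ∘ₗ δ'.ρ = δ.ρ ∘ₗ e.toLinearMap := by
  let ρ : W →ₗ[K] W ⊗[K] C := e.symm.toLinearMap.rTensor C ∘ₗ δ.ρ ∘ₗ e.toLinearMap
  have hρ : e.toLinearMap.rTensor C ∘ₗ ρ = δ.ρ ∘ₗ e.toLinearMap := by
    rw [← LinearMap.comp_assoc, ← LinearMap.rTensor_comp]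
    simp
  exact ⟨.ofJointlyMono (fun _ => δ) (jointlyMono_of_injective e.injective) ρ fun _ => hρ, hρ⟩

end Subcomodules

/-! ### Generation by the modules `V ⊗ h_X` -/

section TensorRepresentable

variable {E : Entwining K C D} {V W : Type u} [AddCommGroup V] [Module K V] [AddCommGroup W]
  [Module K W]

/-- The morphism `V ⊗ h_X → A`, `v ⊗ g ↦ A(g)(φ(v))` attached to a colinear map `φ : V → A(X)`. -/
def tensorRepresentableDesc (δ : RightCoaction K C V) (X : D) (A : EntwinedModule E)
    (φ : V →ₗ[K] A.F.obj (op X)) (hφ : φ.rTensor C ∘ₗ δ.ρ = (A.coact X).ρ ∘ₗ φ) :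
    tensorRepresentable E δ X ⟶ A where
  nat :=
    { app := fun Y => ModuleCat.ofHom (A.act X Y.unop ∘ₗ φ.rTensor (Y.unop ⟶ X))
      naturality := fun Y Z f => by
        ext : 1
        refine TensorProduct.ext' fun v g => ?_
        change (A.F.map (g.op ≫ f)).hom (φ v) = (A.F.map f).hom ((A.F.map g.op).hom (φ v))
        rw [A.F.map_comp]
        rfl }
  colinear Y := by
    change (A.act X Y ∘ₗ φ.rTensor (Y ⟶ X)).rTensor C ∘ₗ E.twist δ.ρ X Y =
      (A.coact Y).ρ ∘ₗ A.act X Y ∘ₗ φ.rTensor (Y ⟶ X)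
    rw [LinearMap.rTensor_comp, LinearMap.comp_assoc, E.rTensor_comp_twist φ hφ,
      ← LinearMap.comp_assoc, ← LinearMap.comp_assoc, A.compat]

/-- Functoriality of `V ⊗ h_X` in the comodule `V`. -/
def tensorRepresentableMap (E : Entwining K C D) {δ : RightCoaction K C V}
    {σ : RightCoaction K C W} (X : D) (φ : V →ₗ[K] W)
    (hφ : φ.rTensor C ∘ₗ δ.ρ = σ.ρ ∘ₗ φ) :
    tensorRepresentable E δ X ⟶ tensorRepresentable E σ X where
  nat :=
    { app := fun Y => ModuleCat.ofHom (φ.rTensor (Y.unop ⟶ X))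
      naturality := fun Y Z f => by
        ext : 1
        exact TensorProduct.ext' fun v g => rfl }
  colinear Y := E.rTensor_comp_twist φ hφ X Y

theorem nonempty_tensorRepresentable_iso (E : Entwining K C D) {δ : RightCoaction K C V}
    {σ : RightCoaction K C W} (X : D) (e : W ≃ₗ[K] V)
    (he : e.toLinearMap.rTensor C ∘ₗ σ.ρ = δ.ρ ∘ₗ e.toLinearMap) :
    Nonempty (tensorRepresentable E δ X ≅ tensorRepresentable E σ X) := by
  have he' : e.symm.toLinearMap.rTensor C ∘ₗ δ.ρ = σ.ρ ∘ₗ e.symm.toLinearMap := by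
    have h1 : δ.ρ = e.toLinearMap.rTensor C ∘ₗ σ.ρ ∘ₗ e.symm.toLinearMap := by
      rw [← LinearMap.comp_assoc, he, LinearMap.comp_assoc]
      simp
    rw [h1, ← LinearMap.comp_assoc, ← LinearMap.rTensor_comp]
    simp
  refine ⟨⟨tensorRepresentableMap E X _ he', tensorRepresentableMap E X _ he, ?_, ?_⟩⟩
  · ext Y : 4
    refine TensorProduct.ext' fun v g => ?_
    exact congrArg (· ⊗ₜ[K] g) (e.apply_symm_apply v)
  · ext Y : 4
    refine TensorProduct.ext' fun v g => ?_
    exact congrArg (· ⊗ₜ[K] g) (e.symm_apply_apply v)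

/-- Every element of an entwined module is in the image of some `V ⊗ h_X` with `V` of finite
dimension. -/
theorem exists_finiteTensorRepresentable_hom (A : EntwinedModule E) (X : D)
    (a : A.F.obj (op X)) : ∃ (G : EntwinedModule E) (_ : finiteTensorRepresentable E G)
      (h : G ⟶ A) (t : G.F.obj (op X)), (h.nat.app (op X)).hom t = a := by
  obtain ⟨p, hp, ha, hρ⟩ := (A.coact X).exists_finiteDimensional_mem a
  obtain ⟨δ, hδ⟩ := (A.coact X).exists_restrict p hρ
  refine ⟨_, ⟨p, inferInstance, inferInstance, hp, δ, X, ⟨Iso.refl _⟩⟩,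
    tensorRepresentableDesc δ X A p.subtype hδ, (⟨a, ha⟩ : p) ⊗ₜ[K] 𝟙 X, ?_⟩
  change (A.F.map (𝟙 (op X))).hom a = a
  rw [A.F.map_id]
  rfl

variable (E)

theorem isSeparating_finiteTensorRepresentable :
    (finiteTensorRepresentable E).IsSeparating := by
  intro A B f g hfg
  ext Y a : 5
  obtain ⟨G, hG, h, t, rfl⟩ := exists_finiteTensorRepresentable_hom A Y.unop a
  have := congrArg (fun k => (EntwinedModule.Hom.nat k).app Y) (hfg G hG h)
  exact LinearMap.congr_fun (congrArg ModuleCat.Hom.hom this) t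

/-- If every such morphism factored through the subobject, the inclusion would be surjective at each
object; it is also injective there, since the forgetful functor preserves monomorphisms. -/
theorem isGenerating_finiteTensorRepresentable :
    IsGenerating (finiteTensorRepresentable E) := by
  intro B A i hi hiso
  by_contra! hall
  refine hiso ?_
  have hmono : Mono ((EntwinedModule.toFunctor E).map i) := inferInstance
  have : ∀ Y, IsIso (i.nat.app Y) := fun Y => by
    have hY : Mono (i.nat.app Y) := (NatTrans.mono_iff_mono_app i.nat).1 hmono Y
    refine (ConcreteCategory.isIso_iff_bijective _).2
      ⟨(ModuleCat.mono_iff_injective _).1 hY, fun a => ?_⟩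
    obtain ⟨G, hG, h, t, rfl⟩ := exists_finiteTensorRepresentable_hom A Y.unop a
    obtain ⟨k, rfl⟩ := hall G hG h
    exact ⟨(k.nat.app Y).hom t, rfl⟩
  have : IsIso ((EntwinedModule.toFunctor E).map i) := NatIso.isIso_of_isIso_app i.nat
  exact isIso_of_reflects_iso i (EntwinedModule.toFunctor E)

/-! ### A small set of generators and the Grothendieck property -/

/-- The entwined modules `Kⁿ ⊗ h_X`. -/
def finTensorRepresentable (i : (n : ℕ) × RightCoaction K C (Fin n → K) × D) :
    EntwinedModule E :=
  tensorRepresentable E i.2.1 i.2.2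

theorem finiteTensorRepresentable_le :
    finiteTensorRepresentable E ≤ (ObjectProperty.ofObj (finTensorRepresentable E)).isoClosure := by
  rintro M ⟨V, _, _, _, δ, X, ⟨f⟩⟩
  let e := (Module.finBasis K V).equivFun.symm
  obtain ⟨σ, hσ⟩ := δ.exists_transport e
  obtain ⟨g⟩ := nonempty_tensorRepresentable_iso E X e hσ
  exact ⟨finTensorRepresentable E ⟨_, σ, X⟩, ⟨_⟩, ⟨f ≪≫ g⟩⟩

theorem essentiallySmall_finiteTensorRepresentable :
    ObjectProperty.EssentiallySmall.{u} (finiteTensorRepresentable E) where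
  exists_small_le' := ⟨_, inferInstance, finiteTensorRepresentable_le E⟩

theorem isSeparating_finTensorRepresentable :
    (ObjectProperty.ofObj (finTensorRepresentable E)).IsSeparating := by
  intro A B f g hfg
  refine isSeparating_finiteTensorRepresentable E f g fun G hG h => ?_
  obtain ⟨H, hH, ⟨e⟩⟩ := finiteTensorRepresentable_le E G hG
  rw [← cancel_epi e.inv, ← Category.assoc, ← Category.assoc]
  exact hfg H hH _

/-- The index type of `finTensorRepresentable` lives in `Type u`, so cocompleteness supplies the
coproduct of the whole family. -/
instance : HasSeparator (EntwinedModule E) :=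
  ⟨_, (isSeparating_finTensorRepresentable E).isSeparator_coproduct⟩

theorem isGrothendieckAbelian :
    @IsGrothendieckAbelian.{u} (EntwinedModule E) _ (EntwinedModule.abelian E) := by
  let := EntwinedModule.abelian E
  exact { locallySmall := inferInstance }

end TensorRepresentable

end Entwined

theorem proposition2p8 (K : Type u) [Field K] (C : Type u) [AddCommGroup C] [Module K C]
    [Coalgebra K C] (D : Type u) [Category.{u} D] [Preadditive D] [Linear K D]
    (E : Entwined.Entwining K C D) :
    (∃ a : Abelian (Entwined.EntwinedModule E),
      a.toPreadditive = Entwined.EntwinedModule.instPreadditive ∧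
      IsGrothendieckAbelian.{u} (Entwined.EntwinedModule E)) ∧
    ObjectProperty.EssentiallySmall.{u} (Entwined.finiteTensorRepresentable E) ∧
    Entwined.IsGenerating (Entwined.finiteTensorRepresentable E) ∧
    (Entwined.finiteTensorRepresentable E).IsSeparating :=
  -- `rfl` works because the abelian structure is built on top of the pointwise addition.
  ⟨⟨Entwined.EntwinedModule.abelian E, rfl, Entwined.isGrothendieckAbelian E⟩,
    Entwined.essentiallySmall_finiteTensorRepresentable E,
    Entwined.isGenerating_finiteTensorRepresentable E,
    Entwined.isSeparating_finiteTensorRepresentable E⟩
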